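/- For $k\ge 1$, let $\Delta_k$ be the set of probability distributions on $[k]=\{1,\dots,k\}$, and for $q,p\in\Delta_k$ let $\mathrm{KL}(q\,\|\,p)=\sum_{i=1}^k q(i)\ln\frac{q(i)}{p(i)}\in[0,\infty]$ be the Kullback--Leibler divergence. A (possibly randomized) estimator with $n$ samples receives $n$ independent samples from an unknown $p\in\Delta_k$ and outputs $\hat p\in\Delta_k$; it learns to accuracy $\varepsilon>0$ with error probability $\delta\in(0,1]$ if, for every $p\in\Delta_k$, $\Pr[\mathrm{KL}(\hat p\,\|\,p)>\varepsilon]\le\delta$. Let $\Phi(\mathrm{KL},k,\varepsilon,\delta)$ be the least $n$ for which such an estimator exists. **Theorem.** $\Phi(\mathrm{KL},k,\varepsilon,\delta)=\Theta\!\left(\frac{k+\log(1/\delta)}{\varepsilon}\right)$, and the upper bound is achieved by the empirical distribution. That is, there are absolute constants $c,C,\varepsilon_0,\delta_0>0$ such that 1. for all $k\ge 2$, $0<\varepsilon\le\varepsilon_0$ and $0<\delta\le\delta_0$: $\ \Phi(\mathrm{KL},k,\varepsilon,\delta)\ge c\,\frac{k+\ln(1/\delta)}{\varepsilon}$; 2.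 for all $k\ge 1$, $0<\varepsilon\le 1$ and $0<\delta\le 1$: $\ \Phi(\mathrm{KL},k,\varepsilon,\delta)\le C\,\frac{k+\ln(1/\delta)}{\varepsilon}$; 3. for all $k\ge 1$, $\varepsilon>0$, $0<\delta\le 1$ and every integer $n\ge C\,\frac{k+\ln(1/\delta)}{\varepsilon}$, the empirical estimator $\hat p(i)=\frac1n\#\{j: s_j=i\}$ of $n$ samples $s_1,\dots,s_n$ learns to accuracy $\varepsilon$ with error probability $\delta$. -/

import Mathlib

open MeasureTheory ProbabilityTheory InformationTheory
open scoped ENNReal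

/-- The probability distributions over the known domain `[k]`. -/
abbrev Distr (k : ℕ) : Type := ProbabilityMeasure (Fin k)

/-- A (possibly randomized) estimator for distributions over `[k]` from `n` samples: a Markov kernel
that maps the observed sample `s₁, …, sₙ` to the law of the output distribution. -/
structure Estimator (k n : ℕ) where
  toKernel : Kernel (Fin n → Fin k) (Distr k)
  isMarkov : IsMarkovKernel toKernel

/-- The law of the output of the estimator `A` when its input consists of `n` independent samples
from `p`. -/
noncomputable def Estimator.outputLaw {k n : ℕ} (A : Estimator k n) (p : Distr k) :
    Measure (Distr k) :=
  (Measure.pi fun _ : Fin n => (p : Measure (Fin k))).bind A.toKernel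

/-- The estimator `A` learns every distribution over `[k]` to accuracy `ε` with respect to `d`, with
error probability at most `δ`. The first argument of `d` is the output of the estimator, the second
one is the unknown distribution `p`. -/
def Estimator.Learns {k n : ℕ} (d : Distr k → Distr k → ℝ≥0∞) (A : Estimator k n) (ε δ : ℝ) :
    Prop :=
  ∀ p : Distr k,
    A.outputLaw p {q | ENNReal.ofReal ε < d q p} ≤ ENNReal.ofReal δ

/-- The sample complexity of learning distributions over `[k]` with respect to `d`: the least number
of samples from which some estimator learns to accuracy `ε` with error probability `δ`
(and `⊤` if there is none). -/
noncomputable def sampleComplexity {k : ℕ} (d : Distr k → Distr k → ℝ≥0∞) (ε δ : ℝ) : ℕ∞ :=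
  ⨅ (n : ℕ) (_ : ∃ A : Estimator k n, A.Learns d ε δ), (n : ℕ∞)

/-- The Kullback-Leibler divergence `KL(q ‖ p) = ∑ i, q i * log (q i / p i)`, with values
in `[0, ∞]`. -/
noncomputable def klLoss {k : ℕ} (q p : Distr k) : ℝ≥0∞ :=
  klDiv (q : Measure (Fin k)) (p : Measure (Fin k))

/-- The empirical distribution `i ↦ (1 / n) * #{j | s j = i}` of a sample of size `n ≥ 1`. -/
noncomputable def empiricalDistr {k n : ℕ} [NeZero n] (s : Fin n → Fin k) : Distr k :=
  ⟨(n : ℝ≥0∞)⁻¹ • ∑ j : Fin n, Measure.dirac (s j), ⟨by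
    simp [ENNReal.inv_mul_cancel (Nat.cast_ne_zero.mpr (NeZero.ne n)) (ENNReal.natCast_ne_top n)]⟩⟩

/-- The (deterministic) estimator that outputs the empirical distribution of its sample. -/
noncomputable def empiricalEstimator (k n : ℕ) [NeZero n] : Estimator k n where
  toKernel := Kernel.deterministic empiricalDistr Measurable.of_discrete
  isMarkov := inferInstance

/-! Upper bound: under the empirical distribution a sample is `exp (n * KL)` times as likely as
under `p`, so the mean of `exp (n * KL / 2)` is a sum of geometric means of two likelihoods. It is
at most `4 ^ k` (`sum_sqrt_prod_mul_prod_letterCount_le`), and Markov's inequality gives the tail `4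
^ k * exp (-n ε / 2)`. Induction on the alphabet reduces the moment to two letters, where Chernoff's
bound makes each side of the mean a telescoping sum of square roots of tail probabilities.

Lower bound: KL dominates the squared Hellinger distance. Group letters into `m = k / 2` pairs and
tilt each by `±η`, with `η ^ 2 = 64 ε`. An accurate output must recover the direction of all but `m
/ 16` tilts (`IsPairFamily.outputLaw_le`), while Le Cam's inequality limits how well `n` samples
distinguish two members (`Estimator.affinity_pow_le`). Opposite tilt vectors give `log (1 / δ) ≲ n
ε` (`IsPairFamily.log_le`). Vectors differing in one coordinate, averaged as in Assouad's lemma,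
give `m ≲ n ε` (`IsPairFamily.card_le`). -/

/-! ### A binomial moment bound -/

/-- A Chernoff bound in multiplicative form: the upper tail of the binomial expansion of
`(a + b) ^ n` beyond `m` is controlled by the change of weights from `(a, b)` to `(m, n - m)`. -/
lemma sum_Ico_choose_mul_le {a b : ℝ} (ha : 0 ≤ a) (hb : 0 ≤ b) {n m : ℕ} (hm : m ≤ n)
    (h : ((n - m : ℕ) : ℝ) * a ≤ m * b) :
    (∑ j ∈ Finset.Ico m (n + 1), (n.choose j : ℝ) * (a ^ j * b ^ (n - j))) *
        ((m : ℝ) ^ m * ((n - m : ℕ) : ℝ) ^ (n - m)) ≤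
      a ^ m * b ^ (n - m) * (n : ℝ) ^ n := by
  have key : ∀ j ∈ Finset.Ico m (n + 1),
      (n.choose j : ℝ) * (a ^ j * b ^ (n - j)) *
        ((m : ℝ) ^ m * ((n - m : ℕ) : ℝ) ^ (n - m)) ≤
      a ^ m * b ^ (n - m) * ((m : ℝ) ^ j * ((n - m : ℕ) : ℝ) ^ (n - j) * n.choose j) := by
    intro j hj
    rw [Finset.mem_Ico] at hj
    obtain ⟨d, rfl⟩ := Nat.exists_eq_add_of_le hj.1
    obtain ⟨e, he⟩ := Nat.exists_eq_add_of_le (Nat.lt_succ_iff.mp hj.2)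
    have h1 : n - (m + d) = e := by omega
    have h2 : n - m = e + d := by omega
    rw [h1]
    set x : ℝ := ((n - m : ℕ) : ℝ) with hx
    rw [h2]
    have hx0 : 0 ≤ x := by positivity
    -- Moving `d` steps beyond `m` changes the two weights by `a ^ d` and `m ^ d` against `b ^ d`
    -- and `(n - m) ^ d`, so `h` is used `d` times.
    calc _ = (n.choose (m + d) : ℝ) * a ^ m * b ^ e * m ^ m * x ^ e * (x * a) ^ d := by ring
      _ ≤ (n.choose (m + d) : ℝ) * a ^ m * b ^ e * m ^ m * x ^ e * (m * b) ^ d := by gcongr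
      _ = _ := by ring
  rw [Finset.sum_mul]
  refine (Finset.sum_le_sum key).trans ?_
  rw [← Finset.mul_sum]
  gcongr
  calc _ ≤ ∑ j ∈ Finset.range (n + 1),
        (m : ℝ) ^ j * ((n - m : ℕ) : ℝ) ^ (n - j) * n.choose j := by
        refine Finset.sum_le_sum_of_subset_of_nonneg ?_ fun _ _ _ => by positivity
        intro j; simp
    _ = (n : ℝ) ^ n := by
        rw [← add_pow]
        congr 1
        rw [← Nat.cast_add]; congr 1; omega

/-- Factor `t - t' = (√t - √t') * (√t + √t')` and use `√t' ≤ √t`. A discrete form of `∫ dt / √t = 2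
√t`, whose right-hand side telescopes. -/
lemma div_sqrt_le_two_mul_sqrt_sub {t t' : ℝ} (h0 : 0 ≤ t') (h : t' ≤ t) (ht : 0 < t) :
    (t - t') / √t ≤ 2 * (√t - √t') := by
  have h1 : 0 < √t := Real.sqrt_pos.mpr ht
  have h2 : √t' ≤ √t := Real.sqrt_le_sqrt h
  have h3 := Real.sq_sqrt ht.le
  have h4 := Real.sq_sqrt h0
  rw [div_le_iff₀ h1]
  nlinarith [Real.sqrt_nonneg t']

/-- The terms of index `m` with `m * b ≥ (n - m) * a` of the binomial moment contribute at most
twice the bound. -/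
lemma sum_filter_choose_mul_sqrt_le {a b : ℝ} (ha : 0 ≤ a) (hb : 0 ≤ b) (n : ℕ) :
    ∑ m ∈ (Finset.range (n + 1)).filter (fun m => ((n - m : ℕ) : ℝ) * a ≤ m * b),
        (n.choose m : ℝ) * √(a ^ m * b ^ (n - m) * ((m : ℝ) ^ m * ((n - m : ℕ) : ℝ) ^ (n - m))) ≤
      2 * √((n : ℝ) ^ n * (a + b) ^ n) := by
  set t : ℕ → ℝ := fun m => ∑ j ∈ Finset.Ico m (n + 1), (n.choose j : ℝ) * (a ^ j * b ^ (n - j))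
    with ht
  have ht0 : ∀ m, 0 ≤ t m := fun m => Finset.sum_nonneg fun _ _ => by positivity
  have hstep : ∀ m ∈ Finset.range (n + 1),
      t m = (n.choose m : ℝ) * (a ^ m * b ^ (n - m)) + t (m + 1) := by
    intro m hm
    simp only [ht]
    rw [Finset.sum_eq_sum_Ico_succ_bot (Finset.mem_range.mp hm)]
  -- Chernoff bounds `√M` by `√(n ^ n * q / t m)`, and `choose * q` is the tail increment `t m - t
  -- (m + 1)`; the term is thus at most `√(n ^ n)` times increment over `√(t m)`.
  have key : ∀ m ∈ Finset.range (n + 1), ((n - m : ℕ) : ℝ) * a ≤ m * b →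
      (n.choose m : ℝ) * √(a ^ m * b ^ (n - m) * ((m : ℝ) ^ m * ((n - m : ℕ) : ℝ) ^ (n - m))) ≤
        √((n : ℝ) ^ n) * (2 * (√(t m) - √(t (m + 1)))) := by
    intro m hm h
    have hmn : m ≤ n := Nat.lt_succ_iff.mp (Finset.mem_range.mp hm)
    have hT := sum_Ico_choose_mul_le ha hb hmn h
    have hs := hstep m hm
    set q := a ^ m * b ^ (n - m) with hq
    set M := (m : ℝ) ^ m * ((n - m : ℕ) : ℝ) ^ (n - m) with hM
    have hM0 : 0 ≤ M := by positivity
    have hq0 : 0 ≤ q := by positivity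
    have hle : t (m + 1) ≤ t m := by
      have : 0 ≤ (n.choose m : ℝ) * q := by positivity
      linarith
    rcases hq0.eq_or_lt with h0 | hqpos
    · rw [← h0]
      simp only [zero_mul, Real.sqrt_zero, mul_zero]
      have := Real.sqrt_le_sqrt hle
      have := Real.sqrt_nonneg ((n : ℝ) ^ n)
      nlinarith
    · have hc : (0 : ℝ) < n.choose m := by exact_mod_cast Nat.choose_pos hmn
      have htpos : 0 < t m := by rw [hs]; have := ht0 (m + 1); positivity
      have h1 := div_sqrt_le_two_mul_sqrt_sub (ht0 (m + 1)) hle htpos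
      refine le_trans ?_ (mul_le_mul_of_nonneg_left h1 (Real.sqrt_nonneg _))
      have h2 : t m - t (m + 1) = n.choose m * q := by rw [hs]; ring
      rw [h2, mul_div_assoc', le_div_iff₀ (Real.sqrt_pos.mpr htpos)]
      have h3 : √(q * M) * √(t m) ≤ √((n : ℝ) ^ n) * q := by
        rw [← Real.sqrt_mul (by positivity)]
        refine Real.sqrt_le_iff.mpr ⟨by positivity, ?_⟩
        rw [mul_pow, Real.sq_sqrt (by positivity)]
        calc q * M * t m = q * (t m * M) := by ring
          _ ≤ q * (q * (n : ℝ) ^ n) := by gcongr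
          _ = _ := by ring
      calc _ = (n.choose m : ℝ) * (√(q * M) * √(t m)) := by ring
        _ ≤ (n.choose m : ℝ) * (√((n : ℝ) ^ n) * q) := by gcongr
        _ = _ := by ring
  calc _ ≤ ∑ m ∈ (Finset.range (n + 1)).filter (fun m => ((n - m : ℕ) : ℝ) * a ≤ m * b),
          √((n : ℝ) ^ n) * (2 * (√(t m) - √(t (m + 1)))) :=
        Finset.sum_le_sum fun m hm => key m (Finset.mem_filter.mp hm).1 (Finset.mem_filter.mp hm).2
    _ ≤ ∑ m ∈ Finset.range (n + 1), √((n : ℝ) ^ n) * (2 * (√(t m) - √(t (m + 1)))) := by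
        refine Finset.sum_le_sum_of_subset_of_nonneg (Finset.filter_subset _ _) fun m hm _ => ?_
        have : √(t (m + 1)) ≤ √(t m) := by
          refine Real.sqrt_le_sqrt ?_
          rw [hstep m hm]
          have : 0 ≤ (n.choose m : ℝ) * (a ^ m * b ^ (n - m)) := by positivity
          linarith
        have := sub_nonneg.mpr this
        positivity
    _ = √((n : ℝ) ^ n) * (2 * √(t 0)) := by
        rw [← Finset.mul_sum, ← Finset.mul_sum, Finset.sum_range_sub']
        simp [ht]
    _ = 2 * √((n : ℝ) ^ n * (a + b) ^ n) := by
        rw [Real.sqrt_mul (by positivity), add_pow]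
        have : t 0 = ∑ m ∈ Finset.range (n + 1), a ^ m * b ^ (n - m) * (n.choose m : ℝ) := by
          simp only [ht]
          rw [← Finset.range_eq_Ico]
          exact Finset.sum_congr rfl fun _ _ => by ring
        rw [this]; ring

/-- For `a + b = 1` this says that `exp (n * KL / 2)` has expectation at most `4`, where `KL` is the
divergence of the empirical distribution of `n` coin flips from the true distribution `(a, b)`. -/
lemma sum_antidiagonal_choose_mul_sqrt_le {a b : ℝ} (ha : 0 ≤ a) (hb : 0 ≤ b) (n : ℕ) :
    ∑ x ∈ Finset.HasAntidiagonal.antidiagonal n,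
        (n.choose x.1 : ℝ) * (√(a ^ x.1 * (x.1 : ℝ) ^ x.1) * √((x.2 : ℝ) ^ x.2 * b ^ x.2)) ≤
      4 * √((n : ℝ) ^ n * (a + b) ^ n) := by
  set f : ℕ × ℕ → ℝ := fun x =>
    (n.choose x.1 : ℝ) * √(a ^ x.1 * b ^ x.2 * ((x.1 : ℝ) ^ x.1 * (x.2 : ℝ) ^ x.2)) with hf
  have hf0 : ∀ x, 0 ≤ f x := fun x => by simp only [hf]; positivity
  have h1 : ∑ x ∈ (Finset.HasAntidiagonal.antidiagonal n).filter (fun x => (x.2 : ℝ) * a ≤ x.1 * b), f x ≤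
      2 * √((n : ℝ) ^ n * (a + b) ^ n) := by
    have := sum_filter_choose_mul_sqrt_le ha hb n
    rw [Finset.sum_filter] at this ⊢
    rwa [Finset.Nat.sum_antidiagonal_eq_sum_range_succ_mk]
  have h2 : ∑ x ∈ (Finset.HasAntidiagonal.antidiagonal n).filter (fun x => (x.1 : ℝ) * b ≤ x.2 * a), f x ≤
      2 * √((n : ℝ) ^ n * (a + b) ^ n) := by
    have := sum_filter_choose_mul_sqrt_le hb ha n
    rw [Finset.sum_filter] at this ⊢
    rw [← Finset.Nat.sum_antidiagonal_swap, Finset.Nat.sum_antidiagonal_eq_sum_range_succ_mk,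
      add_comm a b]
    refine le_of_eq_of_le (Finset.sum_congr rfl fun m hm => ?_) this
    simp only [hf, Prod.swap]
    have hmn : m ≤ n := Nat.lt_succ_iff.mp (Finset.mem_range.mp hm)
    rw [Nat.choose_symm hmn]
    congr 3
    ring
  calc _ = ∑ x ∈ Finset.HasAntidiagonal.antidiagonal n, f x := by
        refine Finset.sum_congr rfl fun x _ => ?_
        simp only [hf]
        rw [← Real.sqrt_mul (by positivity)]
        congr 2; ring
    _ ≤ ∑ x ∈ Finset.HasAntidiagonal.antidiagonal n, ((if (x.2 : ℝ) * a ≤ x.1 * b then f x else 0) +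
          (if (x.1 : ℝ) * b ≤ x.2 * a then f x else 0)) := by
        refine Finset.sum_le_sum fun x _ => ?_
        have := hf0 x
        rcases le_total ((x.2 : ℝ) * a) (x.1 * b) with h | h
        · rw [if_pos h]; split_ifs <;> linarith
        · rw [if_pos h]; split_ifs <;> linarith
    _ ≤ _ := by
        rw [Finset.sum_add_distrib, ← Finset.sum_filter, ← Finset.sum_filter]
        linarith

/-! ### A multinomial moment bound -/

/-- Split off one letter: the multinomial coefficient factors, and the bound for the remaining
letters has the shape of a single letter of weight `∑ i ∈ s, w i`. The two-letter bound then
applies, at the cost of a factor `4` per letter. -/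
lemma sum_piAntidiag_multinomial_le {ι : Type*} [DecidableEq ι] (w : ι → ℝ) (hw : ∀ i, 0 ≤ w i)
    (s : Finset ι) (n : ℕ) :
    ∑ N ∈ s.piAntidiag n,
        (Nat.multinomial s N : ℝ) * ∏ i ∈ s, √(w i ^ N i * (N i : ℝ) ^ N i) ≤
      4 ^ s.card * √((n : ℝ) ^ n * (∑ i ∈ s, w i) ^ n) := by
  induction s using Finset.cons_induction generalizing n with
  | empty =>
    rcases Nat.eq_zero_or_pos n with rfl | hn
    · simp
    · simp [Finset.piAntidiag_empty_of_ne_zero hn.ne', hn.ne']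
  | cons a s ha ih =>
    rw [Finset.piAntidiag_cons, Finset.sum_disjiUnion, Finset.card_cons, Finset.sum_cons]
    have hW : 0 ≤ ∑ i ∈ s, w i := Finset.sum_nonneg fun i _ => hw i
    have hinner : ∀ x ∈ Finset.HasAntidiagonal.antidiagonal n,
        ∑ N ∈ (s.piAntidiag x.2).map (addRightEmbedding fun t => if t = a then x.1 else 0),
          (Nat.multinomial (Finset.cons a s ha) N : ℝ) *
            ∏ i ∈ Finset.cons a s ha, √(w i ^ N i * (N i : ℝ) ^ N i) ≤
        4 ^ s.card * ((n.choose x.1 : ℝ) * (√(w a ^ x.1 * (x.1 : ℝ) ^ x.1) *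
          √((x.2 : ℝ) ^ x.2 * (∑ i ∈ s, w i) ^ x.2))) := by
      intro x hx
      rw [Finset.sum_map]
      calc _ = ∑ N ∈ s.piAntidiag x.2, (n.choose x.1 : ℝ) * √(w a ^ x.1 * (x.1 : ℝ) ^ x.1) *
            ((Nat.multinomial s N : ℝ) * ∏ i ∈ s, √(w i ^ N i * (N i : ℝ) ^ N i)) := by
            refine Finset.sum_congr rfl fun N hN => ?_
            rw [Finset.mem_piAntidiag] at hN
            have hNa : N a = 0 := by
              by_contra h; exact ha (hN.2 a h)
            have hne : ∀ i ∈ s, i ≠ a := fun i hi h => ha (h ▸ hi)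
            set N' : ι → ℕ := addRightEmbedding (fun t => if t = a then x.1 else 0) N with hN'
            have hN'a : N' a = x.1 := by simp [hN', hNa]
            have hN's : ∀ i ∈ s, N' i = N i := fun i hi => by simp [hN', hne i hi]
            rw [Nat.multinomial_cons ha, Finset.prod_cons, hN'a, Finset.sum_congr rfl hN's,
              Nat.multinomial_congr hN's, Finset.prod_congr rfl fun i hi => by rw [hN's i hi]]
            have : x.1 + ∑ i ∈ s, N i = n := by
              rw [hN.1]; exact Finset.HasAntidiagonal.mem_antidiagonal.mp hx
            rw [this]; push_cast; ring
        _ ≤ (n.choose x.1 : ℝ) * √(w a ^ x.1 * (x.1 : ℝ) ^ x.1) *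
              (4 ^ s.card * √((x.2 : ℝ) ^ x.2 * (∑ i ∈ s, w i) ^ x.2)) := by
            rw [← Finset.mul_sum]
            gcongr
            exact ih x.2
        _ = _ := by ring
    refine (Finset.sum_le_sum hinner).trans ?_
    rw [← Finset.mul_sum, pow_succ, mul_assoc]
    gcongr
    exact sum_antidiagonal_choose_mul_sqrt_le (hw a) hW n

/-- Grouping the words of length `n` by the number of occurrences of each letter. -/
lemma sum_function_eq_sum_piAntidiag {k : ℕ} (n : ℕ) (F : (Fin k → ℕ) → ℝ) :
    ∑ s : Fin n → Fin k, F (fun i => (Finset.univ.filter fun j => s j = i).card) =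
      ∑ N ∈ Finset.univ.piAntidiag n, (Nat.multinomial Finset.univ N : ℝ) * F N := by
  -- The linear functional sending each monomial `X ^ N` to `F N`; applied to `(∑ X i) ^ n` expanded
  -- over words and over exponents, it gives the two sides.
  let φ : MvPolynomial (Fin k) ℝ →ₗ[ℝ] ℝ :=
    (MvPolynomial.basisMonomials (Fin k) ℝ).constr ℝ fun N => F N
  have hφ : ∀ N : Fin k →₀ ℕ, φ (MvPolynomial.monomial N 1) = F N := fun N => by
    simpa using (MvPolynomial.basisMonomials (Fin k) ℝ).constr_basis ℝ (fun N => F N) N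
  have hmon : ∀ N : Fin k → ℕ, ∏ i, (MvPolynomial.X i : MvPolynomial (Fin k) ℝ) ^ N i =
      MvPolynomial.monomial (Finsupp.equivFunOnFinite.symm N) 1 := by
    intro N
    rw [MvPolynomial.monomial_eq, Finsupp.prod_fintype _ _ (by simp)]
    simp
  have hφ' : ∀ N : Fin k → ℕ, φ (∏ i, (MvPolynomial.X i : MvPolynomial (Fin k) ℝ) ^ N i) = F N := by
    intro N; rw [hmon, hφ]; simp
  have h1 : φ ((∑ i : Fin k, MvPolynomial.X i) ^ n) =
      ∑ s : Fin n → Fin k, F (fun i => (Finset.univ.filter fun j => s j = i).card) := by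
    rw [Finset.sum_pow', map_sum, Fintype.piFinset_univ]
    refine Finset.sum_congr rfl fun s _ => ?_
    rw [← hφ', ← Finset.prod_fiberwise Finset.univ s]
    congr 1
    refine Finset.prod_congr rfl fun i _ => ?_
    rw [Finset.prod_congr rfl fun j hj => by rw [(Finset.mem_filter.mp hj).2], Finset.prod_const]
  rw [← h1, Finset.sum_pow_eq_sum_piAntidiag, map_sum]
  refine Finset.sum_congr rfl fun N _ => ?_
  rw [← nsmul_eq_mul, map_nsmul, hφ', nsmul_eq_mul]

/-- The number of occurrences of the letter `i` in the word `s`. -/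
def letterCount {k n : ℕ} (s : Fin n → Fin k) (i : Fin k) : ℕ :=
  (Finset.univ.filter fun j => s j = i).card

/-- For a probability vector `w`, the left hand side is the expectation of `exp (n * KL / 2)`,
up to the factor `√(n ^ n)`. -/
lemma sum_sqrt_prod_mul_prod_letterCount_le {k : ℕ} (w : Fin k → ℝ) (hw : ∀ i, 0 ≤ w i) (n : ℕ) :
    ∑ s : Fin n → Fin k,
        √((∏ j, w (s j)) * ∏ i, (letterCount s i : ℝ) ^ letterCount s i) ≤
      4 ^ k * √((n : ℝ) ^ n * (∑ i, w i) ^ n) := by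
  have h := sum_piAntidiag_multinomial_le w hw Finset.univ n
  rw [← sum_function_eq_sum_piAntidiag n fun N => ∏ i, √(w i ^ N i * (N i : ℝ) ^ N i),
    Finset.card_univ, Fintype.card_fin] at h
  refine le_of_eq_of_le (Finset.sum_congr rfl fun s _ => ?_) h
  rw [← Finset.prod_fiberwise Finset.univ s, ← Finset.prod_mul_distrib,
    Real.sqrt_prod _ (fun i _ => ?_)]
  · refine Finset.prod_congr rfl fun i _ => ?_
    rw [Finset.prod_congr rfl fun j hj => by rw [(Finset.mem_filter.mp hj).2], Finset.prod_const]
    rfl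
  · have : 0 ≤ ∏ j with s j = i, w (s j) := Finset.prod_nonneg fun _ _ => hw _
    positivity

/-! ### Distributions on `Fin k` and the law of an estimator -/

/-- The probability of the letter `i`. -/
noncomputable def Distr.mass {k : ℕ} (p : Distr k) (i : Fin k) : ℝ := (p : Measure (Fin k)).real {i}

lemma Distr.mass_nonneg {k : ℕ} (p : Distr k) (i : Fin k) : 0 ≤ p.mass i := measureReal_nonneg

lemma Distr.sum_mass {k : ℕ} (p : Distr k) : ∑ i, p.mass i = 1 := by
  simp only [Distr.mass, sum_measureReal_singleton, Finset.coe_univ, probReal_univ]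

lemma Distr.measurable_mass {k : ℕ} (i : Fin k) : Measurable fun q : Distr k => q.mass i :=
  ((Measure.measurable_coe (MeasurableSet.singleton i)).comp measurable_subtype_coe).ennreal_toReal

lemma Distr.ac_iff {k : ℕ} (q p : Distr k) :
    (q : Measure (Fin k)) ≪ p ↔ ∀ i, p.mass i = 0 → q.mass i = 0 := by
  have hm : ∀ (r : Distr k) i, r.mass i = 0 ↔ (r : Measure (Fin k)) {i} = 0 := fun r i =>
    measureReal_eq_zero_iff
  simp only [hm]
  refine ⟨fun h i hi => h hi, fun h => Measure.AbsolutelyContinuous.mk fun s _ hs => ?_⟩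
  rw [← Set.biUnion_of_singleton s, measure_biUnion_null_iff s.to_countable]
  exact fun i hi => h i (measure_mono_null (Set.singleton_subset_iff.mpr hi) hs)

lemma Distr.mass_rnDeriv {k : ℕ} {q p : Distr k} (h : (q : Measure (Fin k)) ≪ p) (i : Fin k) :
    p.mass i * ((q : Measure (Fin k)).rnDeriv p i).toReal = q.mass i := by
  have h1 := congrArg (fun μ : Measure (Fin k) => (μ {i}).toReal)
    (Measure.withDensity_rnDeriv_eq (q : Measure (Fin k)) p h)
  simp only [withDensity_apply _ (MeasurableSet.singleton i), lintegral_singleton,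
    ENNReal.toReal_mul] at h1
  rw [mul_comm]
  exact h1

lemma klLoss_of_not_ac {k : ℕ} {q p : Distr k} (h : ¬ (q : Measure (Fin k)) ≪ p) :
    klLoss q p = ∞ := klDiv_of_not_ac h

lemma klLoss_eq_ofReal_sum_klFun {k : ℕ} {q p : Distr k} (h : (q : Measure (Fin k)) ≪ p) :
    klLoss q p = ENNReal.ofReal
      (∑ i, p.mass i * klFun ((q : Measure (Fin k)).rnDeriv p i).toReal) := by
  rw [klLoss, klDiv_eq_lintegral_klFun_of_ac h, lintegral_fintype,
    ENNReal.ofReal_sum_of_nonneg fun i _ =>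
      mul_nonneg (p.mass_nonneg i) (klFun_nonneg ENNReal.toReal_nonneg)]
  refine Finset.sum_congr rfl fun i _ => ?_
  rw [ENNReal.ofReal_mul (p.mass_nonneg i), mul_comm, Distr.mass, ofReal_measureReal]

lemma mul_klFun_eq {a b x : ℝ} (ha : 0 ≤ a) (h : a * x = b) :
    a * klFun x = b * Real.log (b / a) + (a - b) := by
  subst h
  rcases ha.eq_or_lt with rfl | ha
  · simp
  · rw [mul_div_cancel_left₀ _ ha.ne', klFun_apply]; ring

lemma klLoss_eq_ofReal_sum_log {k : ℕ} {q p : Distr k} (h : (q : Measure (Fin k)) ≪ p) :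
    klLoss q p = ENNReal.ofReal (∑ i, q.mass i * Real.log (q.mass i / p.mass i)) := by
  rw [klLoss_eq_ofReal_sum_klFun h]
  congr 1
  rw [Finset.sum_congr rfl fun i _ => mul_klFun_eq (p.mass_nonneg i) (Distr.mass_rnDeriv h i),
    Finset.sum_add_distrib, Finset.sum_sub_distrib, p.sum_mass, q.sum_mass]
  ring

/-- The logarithmic sum is measurable in `q` but represents the loss only when `q ≪ p`, since `log
(x / 0) = 0` in Lean; elsewhere the loss is `∞`. Hence the split. -/
lemma measurableSet_lt_klLoss {k : ℕ} (p : Distr k) (ε : ℝ) :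
    MeasurableSet {q : Distr k | ENNReal.ofReal ε < klLoss q p} := by
  have hac : MeasurableSet {q : Distr k | (q : Measure (Fin k)) ≪ p} := by
    simp only [Distr.ac_iff, Set.ofPred_forall]
    exact MeasurableSet.iInter fun i => MeasurableSet.iInter fun _ =>
      Distr.measurable_mass i (measurableSet_singleton 0)
  have hm : Measurable fun q : Distr k =>
      ENNReal.ofReal (∑ i, q.mass i * Real.log (q.mass i / p.mass i)) := by
    refine (Finset.measurable_sum _ fun i _ => ?_).ennreal_ofReal
    exact (Distr.measurable_mass i).mul
      (Real.measurable_log.comp ((Distr.measurable_mass i).div_const _))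
  have : {q : Distr k | ENNReal.ofReal ε < klLoss q p} =
      {q : Distr k | (q : Measure (Fin k)) ≪ p}ᶜ ∪ ({q : Distr k | (q : Measure (Fin k)) ≪ p} ∩
        {q | ENNReal.ofReal ε <
          ENNReal.ofReal (∑ i, q.mass i * Real.log (q.mass i / p.mass i))}) := by
    ext q
    by_cases h : (q : Measure (Fin k)) ≪ p
    · simp [h, klLoss_eq_ofReal_sum_log h]
    · simp [h, klLoss_of_not_ac h]
  rw [this]
  exact hac.compl.union (hac.inter (measurableSet_lt measurable_const hm))

instance {k n : ℕ} (A : Estimator k n) : IsMarkovKernel A.toKernel := A.isMarkov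

instance {k n : ℕ} (A : Estimator k n) (p : Distr k) : IsProbabilityMeasure (A.outputLaw p) := by
  unfold Estimator.outputLaw; infer_instance

/-- The probability of a sample. -/
noncomputable def Distr.sampleMass {k : ℕ} (p : Distr k) {n : ℕ} (s : Fin n → Fin k) : ℝ :=
  ∏ j, p.mass (s j)

lemma Distr.sampleMass_nonneg {k : ℕ} (p : Distr k) {n : ℕ} (s : Fin n → Fin k) :
    0 ≤ p.sampleMass s := Finset.prod_nonneg fun _ _ => p.mass_nonneg _

lemma Estimator.outputLaw_real_apply {k n : ℕ} (A : Estimator k n) (p : Distr k)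
    {B : Set (Distr k)} (hB : MeasurableSet B) :
    (A.outputLaw p).real B = ∑ s, p.sampleMass s * (A.toKernel s).real B := by
  rw [measureReal_def, Estimator.outputLaw,
    Measure.bind_apply hB A.toKernel.measurable.aemeasurable, lintegral_fintype,
    ENNReal.toReal_sum fun s _ => ENNReal.mul_ne_top (measure_ne_top _ _) (measure_ne_top _ _)]
  refine Finset.sum_congr rfl fun s _ => ?_
  rw [ENNReal.toReal_mul, mul_comm, Measure.pi_singleton, ENNReal.toReal_prod]
  rfl

/-! ### The empirical estimator -/

lemma mass_empiricalDistr {k n : ℕ} [NeZero n] (s : Fin n → Fin k) (i : Fin k) :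
    (empiricalDistr s).mass i = letterCount s i / n := by
  have : ((empiricalDistr s : Distr k) : Measure (Fin k)) {i} =
      (n : ℝ≥0∞)⁻¹ * letterCount s i := by
    simp [empiricalDistr, letterCount, Set.indicator_apply, Finset.sum_boole]
  rw [Distr.mass, measureReal_def, this]
  simp [div_eq_inv_mul]

lemma sum_letterCount {k n : ℕ} (s : Fin n → Fin k) : ∑ i, letterCount s i = n := by
  simpa [letterCount] using (Finset.card_eq_sum_card_fiberwise (f := s) (s := Finset.univ)
    (t := Finset.univ) (by simp)).symm

lemma Distr.sampleMass_eq_prod_pow {k n : ℕ} (p : Distr k) (s : Fin n → Fin k) :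
    p.sampleMass s = ∏ i, p.mass i ^ letterCount s i := by
  rw [Distr.sampleMass, ← Finset.prod_fiberwise Finset.univ s]
  refine Finset.prod_congr rfl fun i _ => ?_
  rw [Finset.prod_congr rfl fun j hj => by rw [(Finset.mem_filter.mp hj).2], Finset.prod_const]
  rfl

lemma mass_pos_of_letterCount {k n : ℕ} {p : Distr k} {s : Fin n → Fin k}
    (hs : 0 < p.sampleMass s) {i : Fin k} (hi : letterCount s i ≠ 0) : 0 < p.mass i := by
  refine (p.mass_nonneg i).lt_of_ne fun h => hs.ne' ?_
  rw [p.sampleMass_eq_prod_pow]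
  exact Finset.prod_eq_zero (Finset.mem_univ i) (by rw [← h, zero_pow hi])

/-- The likelihood ratio of the empirical distribution to the true one is `exp (n * KL)`. -/
lemma sampleMass_mul_exp {k n : ℕ} [NeZero n] {p : Distr k} {s : Fin n → Fin k}
    (hs : 0 < p.sampleMass s) :
    p.sampleMass s * Real.exp (n * ∑ i, (empiricalDistr s).mass i *
        Real.log ((empiricalDistr s).mass i / p.mass i)) =
      (∏ i, (letterCount s i : ℝ) ^ letterCount s i) / (n : ℝ) ^ n := by
  have hn : (n : ℝ) ≠ 0 := Nat.cast_ne_zero.mpr (NeZero.ne n)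
  have : (n : ℝ) ^ n = ∏ i, (n : ℝ) ^ letterCount s i := by
    rw [Finset.prod_pow_eq_pow_sum, sum_letterCount]
  rw [this, ← Finset.prod_div_distrib, Finset.mul_sum, Real.exp_sum, p.sampleMass_eq_prod_pow,
    ← Finset.prod_mul_distrib]
  refine Finset.prod_congr rfl fun i _ => ?_
  rw [mass_empiricalDistr, ← mul_assoc, mul_div_cancel₀ _ hn]
  -- An absent letter contributes `1` to both sides, as `0 ^ 0 = 1`.
  rcases Nat.eq_zero_or_pos (letterCount s i) with h | h
  · simp [h]
  · have hp := mass_pos_of_letterCount hs h.ne'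
    have hc : (0 : ℝ) < letterCount s i := by exact_mod_cast h
    have hn' : (0 : ℝ) < n := by positivity
    rw [← Real.log_pow, Real.exp_log (by positivity), ← div_pow, ← mul_pow, mul_div_cancel₀ _ hp.ne']

lemma empirical_ac {k n : ℕ} [NeZero n] {p : Distr k} {s : Fin n → Fin k}
    (hs : 0 < p.sampleMass s) :
    ((empiricalDistr s : Distr k) : Measure (Fin k)) ≪ p := by
  rw [Distr.ac_iff]
  intro i hi
  rw [mass_empiricalDistr]
  by_contra h
  exact (mass_pos_of_letterCount hs (i := i) fun h0 => h (by simp [h0])).ne' hi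

/-- Markov's inequality for `exp (n * KL / 2)`, carried out sample by sample: on a bad sample of
probability `P > 0`, `P * exp (n ε) ≤ R / n ^ n`, and multiplying by `P` bounds `P ^ 2`. -/
lemma outputLaw_empiricalEstimator_le {k n : ℕ} [NeZero n] (p : Distr k) (ε : ℝ) :
    ((empiricalEstimator k n).outputLaw p).real {q | ENNReal.ofReal ε < klLoss q p} ≤
      4 ^ k * Real.exp (-(n * ε / 2)) := by
  have hB := measurableSet_lt_klLoss p ε
  have hn : (0 : ℝ) < n := Nat.cast_pos.mpr (NeZero.pos n)
  rw [Estimator.outputLaw_real_apply _ _ hB]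
  have hterm : ∀ s : Fin n → Fin k, p.sampleMass s *
      ((empiricalEstimator k n).toKernel s).real {q | ENNReal.ofReal ε < klLoss q p} ≤
      √((∏ j, p.mass (s j)) * ∏ i, (letterCount s i : ℝ) ^ letterCount s i) *
        (Real.exp (-(n * ε / 2)) / √((n : ℝ) ^ n)) := by
    intro s
    have hR : 0 ≤ √((∏ j, p.mass (s j)) * ∏ i, (letterCount s i : ℝ) ^ letterCount s i) *
        (Real.exp (-(n * ε / 2)) / √((n : ℝ) ^ n)) := by positivity
    rcases (p.sampleMass_nonneg s).eq_or_lt with h0 | hs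
    · rw [← h0, zero_mul]; exact hR
    by_cases hbad : ENNReal.ofReal ε < klLoss (empiricalDistr s) p
    swap
    · refine le_of_eq_of_le ?_ hR
      rw [measureReal_def, empiricalEstimator, Kernel.deterministic_apply' _ _ hB,
        Set.indicator_of_notMem (by exact hbad)]
      simp
    refine (mul_le_of_le_one_right hs.le measureReal_le_one).trans ?_
    rw [klLoss_eq_ofReal_sum_log (empirical_ac hs)] at hbad
    have hK := (ENNReal.ofReal_lt_ofReal_iff'.mp hbad).1
    have hexp := sampleMass_mul_exp hs
    set K := ∑ i, (empiricalDistr s).mass i * Real.log ((empiricalDistr s).mass i / p.mass i)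
    set R := ∏ i, (letterCount s i : ℝ) ^ letterCount s i
    change p.sampleMass s ≤ √(p.sampleMass s * R) * _
    set P := p.sampleMass s
    have hsq : Real.exp (-(n * ε / 2)) = √(Real.exp (-(n * ε))) := by
      rw [← neg_div, Real.exp_half]
    rw [hsq, ← Real.sqrt_div' _ (by positivity), ← Real.sqrt_mul' _ (by positivity)]
    refine Real.le_sqrt_of_sq_le ?_
    have h1 : P * Real.exp (n * ε) ≤ R / (n : ℝ) ^ n := by
      rw [← hexp]; gcongr
    calc P ^ 2 = P * (P * Real.exp (n * ε)) * Real.exp (-(n * ε)) := by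
          rw [mul_assoc, mul_assoc, ← Real.exp_add]; simp [sq]
      _ ≤ P * (R / (n : ℝ) ^ n) * Real.exp (-(n * ε)) := by gcongr
      _ = _ := by ring
  refine (Finset.sum_le_sum fun s _ => hterm s).trans ?_
  rw [← Finset.sum_mul]
  have h := sum_sqrt_prod_mul_prod_letterCount_le p.mass p.mass_nonneg n
  rw [p.sum_mass, one_pow, mul_one] at h
  have hnn : 0 < √((n : ℝ) ^ n) := by positivity
  calc _ ≤ 4 ^ k * √((n : ℝ) ^ n) * (Real.exp (-(n * ε / 2)) / √((n : ℝ) ^ n)) := by gcongr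
    _ = _ := by field_simp

/-- The constant `4` makes `n ε / 2 ≥ 2 k + 2 log (1 / δ)`, and `2 k` absorbs `k log 4`. -/
lemma empiricalEstimator_learns {k : ℕ} {ε δ : ℝ} (hε : 0 < ε) (hδ : 0 < δ) (hδ1 : δ ≤ 1)
    (n : ℕ) [NeZero n] (hn : 4 * ((k + Real.log (1 / δ)) / ε) ≤ n) :
    (empiricalEstimator k n).Learns klLoss ε δ := by
  intro p
  rw [← ofReal_measureReal]
  refine ENNReal.ofReal_le_ofReal ((outputLaw_empiricalEstimator_le p ε).trans ?_)
  have hlog4 : Real.log 4 ≤ 2 := by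
    rw [show (4 : ℝ) = 2 ^ 2 by norm_num, Real.log_pow]
    have := Real.log_two_lt_d9
    push_cast; linarith
  have hL : 0 ≤ Real.log (1 / δ) := Real.log_nonneg (by rw [le_div_iff₀ hδ]; linarith)
  have h1 : 4 * (k + Real.log (1 / δ)) ≤ n * ε := by
    rwa [mul_div_assoc', div_le_iff₀ hε] at hn
  have h2 : (k : ℝ) * Real.log 4 ≤ k * 2 := by gcongr
  calc (4 : ℝ) ^ k * Real.exp (-(n * ε / 2))
      = Real.exp (k * Real.log 4 + -(n * ε / 2)) := by
        rw [Real.exp_add, mul_comm (k : ℝ), Real.exp_mul, Real.exp_log (by norm_num),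
          Real.rpow_natCast]
    _ ≤ Real.exp (Real.log δ) := by
        rw [one_div, Real.log_inv] at *
        gcongr
        linarith
    _ = δ := Real.exp_log hδ

lemma sampleComplexity_klLoss_le {k : ℕ} (hk : 1 ≤ k) {ε δ : ℝ} (hε : 0 < ε) (hε1 : ε ≤ 1)
    (hδ : 0 < δ) (hδ1 : δ ≤ 1) :
    ((sampleComplexity (klLoss (k := k)) ε δ : ℕ∞) : ℝ≥0∞) ≤
      ENNReal.ofReal (5 * ((k + Real.log (1 / δ)) / ε)) := by
  have hL : 0 ≤ Real.log (1 / δ) := Real.log_nonneg (by rw [le_div_iff₀ hδ]; linarith)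
  have hk' : (1 : ℝ) ≤ k := by exact_mod_cast hk
  set x := (k + Real.log (1 / δ)) / ε with hx
  -- `k ≥ 1` and `ε ≤ 1` enter here: the rounding loss in `⌈4 * x⌉₊` is at most `x`, whence `5`.
  have hx1 : 1 ≤ x := by rw [hx, le_div_iff₀ hε]; linarith
  set n := ⌈4 * x⌉₊ with hn
  have hn0 : 0 < n := Nat.ceil_pos.mpr (by linarith)
  have : NeZero n := ⟨hn0.ne'⟩
  have hlearn := empiricalEstimator_learns (k := k) hε hδ hδ1 n (Nat.le_ceil _)
  have h1 : sampleComplexity (klLoss (k := k)) ε δ ≤ n := iInf₂_le n ⟨_, hlearn⟩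
  have h2 : ((sampleComplexity (klLoss (k := k)) ε δ : ℕ∞) : ℝ≥0∞) ≤ ((n : ℕ∞) : ℝ≥0∞) := by
    exact_mod_cast h1
  refine h2.trans ?_
  rw [ENat.toENNReal_coe, ← ENNReal.ofReal_natCast]
  refine ENNReal.ofReal_le_ofReal ?_
  have := Nat.ceil_lt_add_one (show 0 ≤ 4 * x by linarith)
  linarith

/-! ### Hellinger distance and testing -/

/-- With `x = y ^ 2` this is `log y ≥ 1 - 1 / y`. It is the pointwise form of "squared Hellinger
distance is at most KL". -/
lemma sq_sqrt_sub_one_le_klFun {x : ℝ} (hx : 0 ≤ x) : (√x - 1) ^ 2 ≤ klFun x := by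
  rcases hx.eq_or_lt with rfl | hx
  · simp [klFun_zero]
  obtain ⟨y, hy, rfl⟩ : ∃ y : ℝ, 0 < y ∧ y ^ 2 = x := ⟨√x, Real.sqrt_pos.mpr hx, Real.sq_sqrt hx.le⟩
  rw [Real.sqrt_sq hy.le, klFun_apply, Real.log_pow]
  have h := Real.one_sub_inv_le_log_of_pos hy
  have h2 : y ^ 2 * (1 - y⁻¹) ≤ y ^ 2 * Real.log y := by gcongr
  have h3 : y ^ 2 * (1 - y⁻¹) = y ^ 2 - y := by field_simp
  push_cast
  linarith

lemma sum_sq_sqrt_sub_le_of_klLoss_le {k : ℕ} {q p : Distr k} {ε : ℝ} (hε : 0 ≤ ε)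
    (h : klLoss q p ≤ ENNReal.ofReal ε) :
    ∑ i, (√(q.mass i) - √(p.mass i)) ^ 2 ≤ ε := by
  have hac : (q : Measure (Fin k)) ≪ p := by
    by_contra hac
    rw [klLoss_of_not_ac hac] at h
    exact ENNReal.ofReal_ne_top (top_le_iff.mp h)
  rw [klLoss_eq_ofReal_sum_klFun hac, ENNReal.ofReal_le_ofReal_iff hε] at h
  refine le_trans (Finset.sum_le_sum fun i _ => ?_) h
  rw [← Distr.mass_rnDeriv hac i, Real.sqrt_mul (p.mass_nonneg i)]
  calc _ = √(p.mass i) ^ 2 * (√((q : Measure (Fin k)).rnDeriv p i).toReal - 1) ^ 2 := by ring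
    _ ≤ _ := by
      rw [Real.sq_sqrt (p.mass_nonneg i)]
      exact mul_le_mul_of_nonneg_left (sq_sqrt_sub_one_le_klFun ENNReal.toReal_nonneg)
        (p.mass_nonneg i)

lemma sum_sqrt_sampleMass_mul {k : ℕ} (p p' : Distr k) (n : ℕ) :
    ∑ s : Fin n → Fin k, √(p.sampleMass s) * √(p'.sampleMass s) =
      (∑ i, √(p.mass i) * √(p'.mass i)) ^ n := by
  rw [Finset.sum_pow', Fintype.piFinset_univ]
  refine Finset.sum_congr rfl fun s _ => ?_
  rw [Distr.sampleMass, Distr.sampleMass, Real.sqrt_prod _ fun _ _ => p.mass_nonneg _,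
    Real.sqrt_prod _ fun _ _ => p'.mass_nonneg _, Finset.prod_mul_distrib]

/-- Le Cam's bound: if an event separates the laws of the outputs under `p` and `p'`, then the
Hellinger affinity of the laws of the samples is small. -/
lemma Estimator.affinity_pow_le {k n : ℕ} (A : Estimator k n) (p p' : Distr k)
    {B : Set (Distr k)} (hB : MeasurableSet B) :
    (∑ i, √(p.mass i) * √(p'.mass i)) ^ n ≤
      √((A.outputLaw p).real B) + √((A.outputLaw p').real Bᶜ) := by
  -- Cauchy–Schwarz with the acceptance probability of `B` as weight; the factor for `p'` is at most
  -- `1`. It is applied to `B`, and to `Bᶜ` with the roles exchanged.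
  have key : ∀ (p p' : Distr k) {B : Set (Distr k)}, MeasurableSet B →
      ∑ s, √(p.sampleMass s) * √(p'.sampleMass s) * (A.toKernel s).real B ≤
        √((A.outputLaw p).real B) := by
    intro p p' B hB
    have h := Real.sum_mul_le_sqrt_mul_sqrt Finset.univ
      (fun s => √(p.sampleMass s * (A.toKernel s).real B))
      (fun s => √(p'.sampleMass s * (A.toKernel s).real B))
    have h1 : ∀ (r : Distr k), ∑ s, √(r.sampleMass s * (A.toKernel s).real B) ^ 2 =
        (A.outputLaw r).real B := by
      intro r
      rw [A.outputLaw_real_apply r hB]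
      exact Finset.sum_congr rfl fun s _ =>
        Real.sq_sqrt (mul_nonneg (r.sampleMass_nonneg s) measureReal_nonneg)
    rw [h1, h1] at h
    refine (le_of_eq_of_le (Finset.sum_congr rfl fun s _ => ?_) h).trans
      (mul_le_of_le_one_right (Real.sqrt_nonneg _) (Real.sqrt_le_one.mpr measureReal_le_one))
    rw [Real.sqrt_mul (p.sampleMass_nonneg s), Real.sqrt_mul (p'.sampleMass_nonneg s)]
    have := Real.mul_self_sqrt (measureReal_nonneg (μ := A.toKernel s) (s := B))
    linear_combination -(√(p.sampleMass s) * √(p'.sampleMass s)) * this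
  rw [← sum_sqrt_sampleMass_mul]
  calc _ = ∑ s, √(p.sampleMass s) * √(p'.sampleMass s) * (A.toKernel s).real B +
        ∑ s, √(p'.sampleMass s) * √(p.sampleMass s) * (A.toKernel s).real Bᶜ := by
        rw [← Finset.sum_add_distrib]
        refine Finset.sum_congr rfl fun s _ => ?_
        rw [probReal_compl_eq_one_sub hB]; ring
    _ ≤ _ := add_le_add (key p p' hB) (key p' p hB.compl)

/-! ### A family of distributions that are hard to tell apart -/

lemma exists_distr_mass_eq {k : ℕ} (w : Fin k → ℝ) (hw : ∀ i, 0 ≤ w i) (h1 : ∑ i, w i = 1) :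
    ∃ p : Distr k, ∀ i, p.mass i = w i := by
  refine ⟨⟨∑ i, ENNReal.ofReal (w i) • Measure.dirac i, ⟨?_⟩⟩, fun i => ?_⟩
  · simp [← ENNReal.ofReal_sum_of_nonneg fun i _ => hw i, h1]
  · simp [Distr.mass, measureReal_def, Set.indicator_apply, hw]

/-- A probability vector on pairs of letters: in the `j`-th pair the letter `v j` is slightly more
likely than the other one. -/
noncomputable def pairMass {m : ℕ} (η : ℝ) (v : Fin m → Bool) (x : Fin m × Bool) : ℝ :=
  (1 + if x.2 = v x.1 then η else -η) / (2 * m)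

lemma pairMass_nonneg {m : ℕ} {η : ℝ} (h0 : 0 ≤ η) (h1 : η ≤ 1) (v : Fin m → Bool)
    (x : Fin m × Bool) : 0 ≤ pairMass η v x := by
  unfold pairMass
  split_ifs
  · positivity
  · have : 0 ≤ 1 + -η := by linarith
    positivity

lemma sum_pair {m : ℕ} (v : Fin m → Bool) (f : Fin m × Bool → ℝ) :
    ∑ x, f x = ∑ j, (f (j, v j) + f (j, !v j)) := by
  rw [Fintype.sum_prod_type]
  refine Finset.sum_congr rfl fun j _ => ?_
  cases v j <;> simp [add_comm]

lemma pairMass_self {m : ℕ} (η : ℝ) (v : Fin m → Bool) (j : Fin m) :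
    pairMass η v (j, v j) = (1 + η) / (2 * m) := by simp [pairMass]

lemma pairMass_not {m : ℕ} (η : ℝ) (v : Fin m → Bool) (j : Fin m) :
    pairMass η v (j, !v j) = (1 - η) / (2 * m) := by simp [pairMass, sub_eq_add_neg]

lemma sum_pairMass {m : ℕ} (hm : 0 < m) (η : ℝ) (v : Fin m → Bool) :
    ∑ x, pairMass η v x = 1 := by
  have : (0 : ℝ) < m := by exact_mod_cast hm
  rw [sum_pair v]
  simp only [pairMass_self, pairMass_not, Finset.sum_const, Finset.card_univ, Fintype.card_fin,
    nsmul_eq_mul]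
  field_simp
  ring

lemma sqrt_mul_sqrt_pair {η : ℝ} (h1 : η ≤ 1) (h0 : 0 ≤ η) (m : ℕ) :
    √((1 + η) / (2 * m)) * √((1 - η) / (2 * m)) = √(1 - η ^ 2) / (2 * m) := by
  have : 0 ≤ 1 - η := by linarith
  rw [← Real.sqrt_mul (by positivity), div_mul_div_comm,
    Real.sqrt_div' _ (by positivity), Real.sqrt_mul_self (by positivity)]
  congr 2; ring

lemma sum_sqrt_pairMass_mul {m : ℕ} {η : ℝ} (h0 : 0 ≤ η) (h1 : η ≤ 1)
    (v v' : Fin m → Bool) :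
    ∑ x, √(pairMass η v x) * √(pairMass η v' x) =
      ∑ j, (if v j = v' j then 1 else √(1 - η ^ 2)) / m := by
  rw [sum_pair v]
  refine Finset.sum_congr rfl fun j _ => ?_
  rw [pairMass_self, pairMass_not]
  have h2 : 0 ≤ 1 - η := by linarith
  split_ifs with h
  · rw [h, pairMass_self, pairMass_not, Real.mul_self_sqrt (by positivity),
      Real.mul_self_sqrt (by positivity)]
    ring
  · have h' : v j = !v' j := by
      revert h; cases v j <;> cases v' j <;> simp
    rw [h', Bool.not_not, pairMass_self, pairMass_not, mul_comm √((1 - η) / (2 * m)),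
      sqrt_mul_sqrt_pair h1 h0]
    ring

/-- The distributions with masses `pairMass η v` on the letters `e (j, b)`. -/
def IsPairFamily {k m : ℕ} (η : ℝ) (e : Fin m × Bool → Fin k) (p : (Fin m → Bool) → Distr k) :
    Prop :=
  ∀ v, (∀ x, (p v).mass (e x) = pairMass η v x) ∧ ∀ i, i ∉ Set.range e → (p v).mass i = 0

lemma exists_isPairFamily {k m : ℕ} (hm : 0 < m) {η : ℝ} (h0 : 0 ≤ η) (h1 : η ≤ 1)
    {e : Fin m × Bool → Fin k} (he : e.Injective) : ∃ p, IsPairFamily η e p := by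
  have : ∀ v : Fin m → Bool, ∃ p : Distr k, ∀ i, p.mass i = Function.extend e (pairMass η v) 0 i := by
    intro v
    refine exists_distr_mass_eq _ (fun i => ?_) ?_
    · by_cases hi : ∃ x, e x = i
      · obtain ⟨x, rfl⟩ := hi
        rw [he.extend_apply]; exact pairMass_nonneg h0 h1 v x
      · rw [Function.extend_apply' _ _ _ hi]; rfl
    · rw [← sum_pairMass hm η v]
      exact (Fintype.sum_of_injective e he _ _
        (fun i hi => by rw [Function.extend_apply' _ _ _ hi]; rfl)
        (fun x => (he.extend_apply _ _ x).symm)).symm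
  choose p hp using this
  exact ⟨p, fun v => ⟨fun x => by rw [hp, he.extend_apply],
    fun i hi => by rw [hp, Function.extend_apply' _ _ _ hi]; rfl⟩⟩

lemma IsPairFamily.affinity {k m : ℕ} {η : ℝ} (h0 : 0 ≤ η) (h1 : η ≤ 1)
    {e : Fin m × Bool → Fin k} (he : e.Injective) {p : (Fin m → Bool) → Distr k}
    (hp : IsPairFamily η e p) (v v' : Fin m → Bool) :
    ∑ i, √((p v).mass i) * √((p v').mass i) =
      ∑ j, (if v j = v' j then 1 else √(1 - η ^ 2)) / m := by
  rw [← sum_sqrt_pairMass_mul h0 h1]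
  refine (Fintype.sum_of_injective e he _ _ (fun i hi => ?_) fun x => ?_).symm
  · rw [(hp v).2 i hi]; simp
  · rw [(hp v).1, (hp v').1]

/-- Which letter of the `j`-th pair `q` prefers. -/
noncomputable def guess {k m : ℕ} (e : Fin m × Bool → Fin k) (q : Distr k) (j : Fin m) : Bool :=
  decide (q.mass (e (j, false)) < q.mass (e (j, true)))

lemma measurable_guess {k m : ℕ} (e : Fin m × Bool → Fin k) (j : Fin m) :
    Measurable fun q : Distr k => guess e q j := by
  refine measurable_to_bool ?_
  have : (fun q : Distr k => guess e q j) ⁻¹' {true} =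
      {q | q.mass (e (j, false)) < q.mass (e (j, true))} := by
    ext q; simp [guess]
  rw [this]
  exact measurableSet_lt (Distr.measurable_mass _) (Distr.measurable_mass _)

/-- The number of pairs in which `q` prefers the wrong letter. -/
noncomputable def wrongGuesses {k m : ℕ} (e : Fin m × Bool → Fin k) (v : Fin m → Bool)
    (q : Distr k) : ℝ :=
  ∑ j, {q : Distr k | guess e q j ≠ v j}.indicator 1 q

lemma measurableSet_guess_ne {k m : ℕ} (e : Fin m × Bool → Fin k) (j : Fin m) (b : Bool) :
    MeasurableSet {q : Distr k | guess e q j ≠ b} :=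
  (measurable_guess e j (measurableSet_singleton b)).compl

lemma measurable_wrongGuesses {k m : ℕ} (e : Fin m × Bool → Fin k) (v : Fin m → Bool) :
    Measurable (wrongGuesses e v) :=
  Finset.measurable_sum _ fun j _ => measurable_one.indicator (measurableSet_guess_ne e j (v j))

/-- With `s ≥ t` the two roots, `x ≤ y` forces the sum to be at least `(s - t) ^ 2 / 2`, and `(s -
t) ^ 2 = (1 - √(1 - η ^ 2)) / m ≥ η ^ 2 / (2 m)`. This is the Hellinger cost of one misordered pair.
-/
lemma sq_le_sum_sq_sqrt_sub {η : ℝ} (h0 : 0 ≤ η) (h1 : η ≤ 1) (m : ℕ) {x y : ℝ}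
    (hxy : x ≤ y) :
    η ^ 2 / (4 * m) ≤ (x - √((1 + η) / (2 * m))) ^ 2 + (y - √((1 - η) / (2 * m))) ^ 2 := by
  have h2 : 0 ≤ 1 - η := by linarith
  have hst := sqrt_mul_sqrt_pair h1 h0 m
  have hs := Real.sq_sqrt (show 0 ≤ (1 + η) / (2 * m) by positivity)
  have ht := Real.sq_sqrt (show 0 ≤ (1 - η) / (2 * m) by positivity)
  have hle : √((1 - η) / (2 * m)) ≤ √((1 + η) / (2 * m)) := by
    apply Real.sqrt_le_sqrt
    gcongr
    linarith
  have hr : √(1 - η ^ 2) ≤ 1 - η ^ 2 / 2 := by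
    refine Real.sqrt_le_iff.mpr ⟨by nlinarith, by nlinarith [sq_nonneg (η ^ 2)]⟩
  have hr' : √(1 - η ^ 2) / (2 * m) ≤ (1 - η ^ 2 / 2) / (2 * m) := by gcongr
  set s := √((1 + η) / (2 * m))
  set t := √((1 - η) / (2 * m))
  have hsq : η ^ 2 / (2 * m) ≤ (s - t) ^ 2 := by
    have e1 : (s - t) ^ 2 = s ^ 2 + t ^ 2 - 2 * (s * t) := by ring
    have e2 : η ^ 2 / (2 * m) =
        (1 + η) / (2 * m) + (1 - η) / (2 * m) - 2 * ((1 - η ^ 2 / 2) / (2 * m)) := by ring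
    rw [e1, e2, hs, ht, hst]
    linarith
  have e3 : η ^ 2 / (4 * m) = η ^ 2 / (2 * m) / 2 := by rw [div_div]; ring
  rw [e3]
  nlinarith [sq_nonneg ((x - s) + (y - t))]

lemma IsPairFamily.wrongGuesses_mul_le {k m : ℕ} {η : ℝ} (h0 : 0 ≤ η) (h1 : η ≤ 1)
    {e : Fin m × Bool → Fin k} (he : e.Injective) {p : (Fin m → Bool) → Distr k}
    (hp : IsPairFamily η e p) (v : Fin m → Bool) (q : Distr k) :
    wrongGuesses e v q * (η ^ 2 / (4 * m)) ≤ ∑ i, (√(q.mass i) - √((p v).mass i)) ^ 2 := by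
  have h2 : ∑ x, (√(q.mass (e x)) - √(pairMass η v x)) ^ 2 ≤
      ∑ i, (√(q.mass i) - √((p v).mass i)) ^ 2 := by
    simp only [← (hp v).1]
    rw [← Finset.sum_image (f := fun i => (√(q.mass i) - √((p v).mass i)) ^ 2)
      (s := Finset.univ) (g := e) (fun x _ y _ h => he h)]
    exact Finset.sum_le_univ_sum_of_nonneg fun _ => sq_nonneg _
  refine le_trans ?_ h2
  rw [sum_pair v, wrongGuesses, Finset.sum_mul]
  refine Finset.sum_le_sum fun j _ => ?_
  rw [pairMass_self, pairMass_not]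
  by_cases hg : guess e q j ≠ v j
  · rw [Set.indicator_of_mem (by exact hg), Pi.one_apply, one_mul]
    refine sq_le_sum_sq_sqrt_sub h0 h1 m (Real.sqrt_le_sqrt ?_)
    revert hg
    cases v j
    · simpa [guess] using le_of_lt
    · simp [guess]
  · rw [Set.indicator_of_notMem (by exact hg), zero_mul]
    positivity

/-- An accurate output gets most of the pairs right. -/
lemma IsPairFamily.outputLaw_le {k m n : ℕ} (hm : 0 < m) {η ε δ : ℝ} (h0 : 0 ≤ η) (h1 : η ≤ 1)
    (hε : 0 < ε) (hη : η ^ 2 = 64 * ε) (hδ : 0 ≤ δ)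
    {e : Fin m × Bool → Fin k} (he : e.Injective) {p : (Fin m → Bool) → Distr k}
    (hp : IsPairFamily η e p) {A : Estimator k n} (hA : A.Learns klLoss ε δ) (v : Fin m → Bool) :
    (A.outputLaw (p v)).real {q | (m : ℝ) / 16 < wrongGuesses e v q} ≤ δ := by
  refine ENNReal.toReal_le_of_le_ofReal hδ (le_trans (measure_mono fun q hq => ?_) (hA (p v)))
  by_contra hle
  have h := (hp.wrongGuesses_mul_le h0 h1 he v q).trans
    (sum_sq_sqrt_sub_le_of_klLoss_le hε.le (not_lt.mp hle))
  have hm' : (0 : ℝ) < m := by exact_mod_cast hm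
  have hq : (m : ℝ) / 16 < wrongGuesses e v q := hq
  have : (m : ℝ) / 16 * (η ^ 2 / (4 * m)) < wrongGuesses e v q * (η ^ 2 / (4 * m)) := by
    have : 0 < η ^ 2 := by rw [hη]; positivity
    gcongr
  -- The choice `η ^ 2 = 64 ε` makes `m / 16` wrong pairs cost exactly `ε`.
  have e1 : (m : ℝ) / 16 * (η ^ 2 / (4 * m)) = ε := by
    rw [hη]; field_simp; norm_num
  linarith

/-! ### The lower bound -/

/-- The dependence on `δ`, by comparing two opposite members of the family. -/
lemma IsPairFamily.log_le {k m n : ℕ} (hm : 0 < m) {η ε δ : ℝ} (h0 : 0 ≤ η) (h1 : η ≤ 1)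
    (hε : 0 < ε) (hε1 : ε ≤ 1 / 128) (hη : η ^ 2 = 64 * ε) (hδ : 0 < δ) (hδ1 : δ ≤ 1 / 16)
    {e : Fin m × Bool → Fin k} (he : e.Injective) {p : (Fin m → Bool) → Distr k}
    (hp : IsPairFamily η e p) {A : Estimator k n} (hA : A.Learns klLoss ε δ) :
    Real.log (1 / δ) ≤ 256 * (n * ε) := by
  have hm' : (0 : ℝ) < m := by exact_mod_cast hm
  set v : Fin m → Bool := fun _ => true
  set v' : Fin m → Bool := fun _ => false
  have hB : MeasurableSet {q | (m : ℝ) / 16 < wrongGuesses e v q} :=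
    measurableSet_lt measurable_const (measurable_wrongGuesses e v)
  -- Every guess is wrong for exactly one of the opposite vectors, so no output is accurate for
  -- both.
  have hsum : ∀ q : Distr k, wrongGuesses e v q + wrongGuesses e v' q = m := by
    intro q
    have : ∀ j : Fin m, ({q : Distr k | guess e q j ≠ v j}.indicator 1 q : ℝ) +
        {q : Distr k | guess e q j ≠ v' j}.indicator 1 q = 1 := by
      intro j
      cases h : guess e q j <;> simp [v, v', h]
    rw [wrongGuesses, wrongGuesses, ← Finset.sum_add_distrib, Finset.sum_congr rfl fun j _ => this j]
    simp
  have hle1 := hp.outputLaw_le hm h0 h1 hε hη hδ.le he hA v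
  have hle2 : (A.outputLaw (p v')).real {q | (m : ℝ) / 16 < wrongGuesses e v q}ᶜ ≤ δ := by
    refine le_trans (measureReal_mono fun q hq => ?_)
      (hp.outputLaw_le hm h0 h1 hε hη hδ.le he hA v')
    have hq : ¬ (m : ℝ) / 16 < wrongGuesses e v q := hq
    have := hsum q
    change (m : ℝ) / 16 < wrongGuesses e v' q
    linarith
  have h := A.affinity_pow_le (p v) (p v') hB
  have haff : ∑ i, √((p v).mass i) * √((p v').mass i) = √(1 - η ^ 2) := by
    rw [hp.affinity h0 h1 he]
    simp [v, v']
    field_simp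
  rw [haff] at h
  have h3 : √(1 - η ^ 2) ^ n ≤ 2 * √δ := by
    have := Real.sqrt_le_sqrt hle1
    have := Real.sqrt_le_sqrt hle2
    linarith
  have hpos : 0 < 1 - η ^ 2 := by rw [hη]; linarith
  have h4 : (1 - η ^ 2) ^ n ≤ 4 * δ := by
    have : (√(1 - η ^ 2) ^ n) ^ 2 ≤ (2 * √δ) ^ 2 := by gcongr
    rw [← pow_mul, mul_comm n 2, pow_mul, Real.sq_sqrt hpos.le, mul_pow, Real.sq_sqrt hδ.le] at this
    linarith
  have h5 := Real.log_le_log (by positivity) h4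
  rw [Real.log_pow, Real.log_mul (by norm_num) hδ.ne'] at h5
  -- Needs `η ^ 2 ≤ 1 / 2`, which is the origin of `ε ≤ 1 / 128`.
  have h6 : -(2 * η ^ 2) ≤ Real.log (1 - η ^ 2) := by
    refine le_trans ?_ (Real.one_sub_inv_le_log_of_pos hpos)
    have h7 : η ^ 2 ≤ 1 / 2 := by rw [hη]; linarith
    have h8 : (1 - η ^ 2)⁻¹ ≤ 1 + 2 * η ^ 2 := by
      rw [inv_le_iff_one_le_mul₀ hpos]
      nlinarith [sq_nonneg η]
    linarith
  -- `δ ≤ 1 / 16` lets half of `log (1 / δ)` absorb the factor `4` in `h4`.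
  have h8 : 2 * Real.log 4 ≤ Real.log (1 / δ) := by
    have : Real.log ((4 : ℝ) ^ 2) ≤ Real.log (1 / δ) := by
      apply Real.log_le_log (by norm_num)
      rw [le_div_iff₀ hδ]; linarith
    rw [Real.log_pow] at this
    exact_mod_cast this
  rw [hη] at h6
  have h7 : (n : ℝ) * -(2 * (64 * ε)) ≤ n * Real.log (1 - 64 * ε) := by gcongr
  rw [hη] at h5
  rw [one_div, Real.log_inv] at h8 ⊢
  linarith

/-- The tangent line at `1 / 9`, close to the mean error bound `1 / 8`, where it gives `17 / 48 < 1
/ 2`. -/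
lemma sqrt_le_three_halves_mul_add (x : ℝ) (hx : 0 ≤ x) : √x ≤ 3 / 2 * x + 1 / 6 := by
  nlinarith [Real.sq_sqrt hx, sq_nonneg (3 * √x - 1)]

/-- The expected number of wrong guesses is small. -/
lemma IsPairFamily.sum_outputLaw_le {k m n : ℕ} (hm : 0 < m) {η ε δ : ℝ} (h0 : 0 ≤ η) (h1 : η ≤ 1)
    (hε : 0 < ε) (hη : η ^ 2 = 64 * ε) (hδ : 0 < δ) (hδ1 : δ ≤ 1 / 16)
    {e : Fin m × Bool → Fin k} (he : e.Injective) {p : (Fin m → Bool) → Distr k}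
    (hp : IsPairFamily η e p) {A : Estimator k n} (hA : A.Learns klLoss ε δ) (v : Fin m → Bool) :
    ∑ j, (A.outputLaw (p v)).real {q | guess e q j ≠ v j} ≤ m / 8 := by
  have hB : MeasurableSet {q | (m : ℝ) / 16 < wrongGuesses e v q} :=
    measurableSet_lt measurable_const (measurable_wrongGuesses e v)
  have hint : ∀ {S : Set (Distr k)}, MeasurableSet S →
      Integrable (S.indicator (1 : Distr k → ℝ)) (A.outputLaw (p v)) := fun hS =>
    (integrable_const (1 : ℝ)).indicator hS
  -- At most `m / 16` errors off the bad event and at most `m` on it; the bad event has probability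
  -- at most `1 / 16`.
  have hle : ∀ q, wrongGuesses e v q ≤
      m / 16 + m * {q | (m : ℝ) / 16 < wrongGuesses e v q}.indicator (1 : Distr k → ℝ) q := by
    intro q
    by_cases hq : (m : ℝ) / 16 < wrongGuesses e v q
    · rw [Set.indicator_of_mem (by exact hq), Pi.one_apply, mul_one]
      have : wrongGuesses e v q ≤ ∑ _j : Fin m, (1 : ℝ) :=
        Finset.sum_le_sum fun j _ => Set.indicator_apply_le' (fun _ => le_rfl) fun _ => zero_le_one
      simp at this
      have : (0 : ℝ) ≤ m / 16 := by positivity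
      linarith
    · rw [Set.indicator_of_notMem (by exact hq), mul_zero, add_zero]
      exact not_lt.mp hq
  calc _ = ∑ j, ∫ q, {q : Distr k | guess e q j ≠ v j}.indicator (1 : Distr k → ℝ) q
          ∂(A.outputLaw (p v)) :=
        Finset.sum_congr rfl fun j _ => (integral_indicator_one (measurableSet_guess_ne e j _)).symm
    _ = ∫ q, wrongGuesses e v q ∂(A.outputLaw (p v)) :=
        (integral_finsetSum _ fun j _ => hint (measurableSet_guess_ne e j _)).symm
    _ ≤ ∫ q, (m / 16 + m * {q | (m : ℝ) / 16 < wrongGuesses e v q}.indicator (1 : Distr k → ℝ) q)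
          ∂(A.outputLaw (p v)) :=
        integral_mono (integrable_finsetSum _ fun j _ => hint (measurableSet_guess_ne e j _))
          ((integrable_const _).add ((hint hB).const_mul _)) hle
    _ = m / 16 + m * (A.outputLaw (p v)).real {q | (m : ℝ) / 16 < wrongGuesses e v q} := by
        rw [integral_add (integrable_const _) ((hint hB).const_mul _), integral_const_mul,
          integral_indicator_one hB]
        simp
    _ ≤ m / 16 + m * (1 / 16) := by
        gcongr
        exact (hp.outputLaw_le hm h0 h1 hε hη hδ.le he hA v).trans hδ1
    _ = _ := by ring

/-- The dependence on the number of letters, by Assouad's method. -/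
lemma IsPairFamily.card_le {k m n : ℕ} (hm : 0 < m) {η ε δ : ℝ} (h0 : 0 ≤ η) (h1 : η ≤ 1)
    (hε : 0 < ε) (hη : η ^ 2 = 64 * ε) (hδ : 0 < δ) (hδ1 : δ ≤ 1 / 16)
    {e : Fin m × Bool → Fin k} (he : e.Injective) {p : (Fin m → Bool) → Distr k}
    (hp : IsPairFamily η e p) {A : Estimator k n} (hA : A.Learns klLoss ε δ) :
    (m : ℝ) ≤ 256 * (n * ε) := by
  have hm' : (0 : ℝ) < m := by exact_mod_cast hm
  have hm1 : (1 : ℝ) ≤ m := by exact_mod_cast hm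
  set err : (Fin m → Bool) → Fin m → ℝ := fun v j =>
    (A.outputLaw (p v)).real {q | guess e q j ≠ v j}
  let flip : Fin m → (Fin m → Bool) → (Fin m → Bool) := fun j v => Function.update v j (!v j)
  have hflip : ∀ j, Function.Involutive (flip j) := by
    intro j v; simp [flip]
  -- Only the flipped pair loses affinity, and `1 - √(1 - η ^ 2) ≤ η ^ 2`. Bernoulli's inequality
  -- then handles `n` samples.
  have haff : ∀ v j, 1 - η ^ 2 / m ≤ ∑ i, √((p v).mass i) * √((p (flip j v)).mass i) := by
    intro v j
    rw [hp.affinity h0 h1 he]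
    have hle : ∀ i : Fin m, (1 - if i = j then η ^ 2 else 0) / m ≤
        (if v i = flip j v i then 1 else √(1 - η ^ 2)) / m := by
      intro i
      by_cases hij : i = j
      · subst hij
        have : 1 - η ^ 2 ≤ √(1 - η ^ 2) :=
          Real.le_sqrt_of_sq_le (by
            have : η ^ 2 ≤ 1 := pow_le_one₀ h0 h1
            nlinarith [sq_nonneg η])
        simp only [flip, Function.update_self, if_true]
        rw [if_neg (by simp)]
        gcongr
      · simp [flip, hij]
    refine le_of_eq_of_le ?_ (Finset.sum_le_sum fun i _ => hle i)
    rw [← Finset.sum_div, Finset.sum_sub_distrib]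
    simp
    field_simp
  have hpair : ∀ v j, 1 - n * (η ^ 2 / m) ≤ √(err v j) + √(err (flip j v) j) := by
    intro v j
    have h := A.affinity_pow_le (p v) (p (flip j v)) (measurableSet_guess_ne e j (v j))
    have hc : {q : Distr k | guess e q j ≠ v j}ᶜ = {q | guess e q j ≠ flip j v j} := by
      ext q
      simp [flip]
    rw [hc] at h
    refine le_trans ?_ h
    have hx : η ^ 2 / m ≤ 1 := by
      rw [div_le_one hm']; nlinarith
    have hb := one_add_mul_le_pow (a := -(η ^ 2 / m)) (by linarith) n
    calc _ = 1 + n * -(η ^ 2 / m) := by ring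
      _ ≤ (1 + -(η ^ 2 / m)) ^ n := hb
      _ ≤ _ := by
        gcongr
        · linarith
        · have := haff v j; linarith
  set V : ℝ := (Fintype.card (Fin m → Bool) : ℝ)
  have hV : 0 < V := by simp only [V]; exact_mod_cast Fintype.card_pos
  have hE : ∑ j, ∑ v, √(err v j) ≤ V * (m * (17 / 48)) := by
    rw [Finset.sum_comm]
    have : ∀ v, ∑ j, √(err v j) ≤ m * (17 / 48) := by
      intro v
      calc _ ≤ ∑ j, (3 / 2 * err v j + 1 / 6) :=
            Finset.sum_le_sum fun j _ => sqrt_le_three_halves_mul_add _ measureReal_nonneg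
        _ = 3 / 2 * ∑ j, err v j + m * (1 / 6) := by
            rw [Finset.sum_add_distrib, ← Finset.mul_sum]; simp
        _ ≤ 3 / 2 * (m / 8) + m * (1 / 6) := by
            gcongr
            exact hp.sum_outputLaw_le hm h0 h1 hε hη hδ hδ1 he hA v
        _ = _ := by ring
    refine (Finset.sum_le_sum fun v _ => this v).trans ?_
    simp [V]
  -- Flipping permutes the cube, so averaging `hpair` over it compares `1 - n η ^ 2 / m` with twice
  -- the mean of `√err`, at most `17 / 24`.
  have hE' : ∑ j, ∑ v, √(err (flip j v) j) = ∑ j, ∑ v, √(err v j) :=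
    Finset.sum_congr rfl fun j _ =>
      Equiv.sum_comp (hflip j).toPerm fun v => √(err v j)
  have htot : V * (m * (1 - n * (η ^ 2 / m))) ≤ 2 * (V * (m * (17 / 48))) := by
    calc _ = ∑ _j : Fin m, ∑ _v : Fin m → Bool, (1 - n * (η ^ 2 / m)) := by
          simp only [Finset.sum_const, Finset.card_univ, Fintype.card_fin, nsmul_eq_mul, V]; ring
      _ ≤ ∑ j, ∑ v, (√(err v j) + √(err (flip j v) j)) :=
          Finset.sum_le_sum fun j _ => Finset.sum_le_sum fun v _ => hpair v j
      _ = ∑ j, ∑ v, √(err v j) + ∑ j, ∑ v, √(err (flip j v) j) := by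
          simp only [Finset.sum_add_distrib]
      _ ≤ _ := by rw [hE']; linarith
  have h3 : m * (1 - n * (η ^ 2 / m)) ≤ 2 * (m * (17 / 48)) := by
    refine le_of_mul_le_mul_left ?_ hV
    linarith
  have h4 : m * (1 - n * (η ^ 2 / m)) = m - n * η ^ 2 := by field_simp
  rw [h4, hη] at h3
  linarith

lemma Estimator.Learns.le_mul {k n : ℕ} (hk : 2 ≤ k) {ε δ : ℝ} (hε : 0 < ε) (hε1 : ε ≤ 1 / 128)
    (hδ : 0 < δ) (hδ1 : δ ≤ 1 / 16) {A : Estimator k n} (hA : A.Learns klLoss ε δ) :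
    1 / 1024 * ((k + Real.log (1 / δ)) / ε) ≤ n := by
  have hm : 0 < k / 2 := by omega
  have hη : √(64 * ε) ^ 2 = 64 * ε := Real.sq_sqrt (by positivity)
  have h0 : 0 ≤ √(64 * ε) := Real.sqrt_nonneg _
  have h1 : √(64 * ε) ≤ 1 := Real.sqrt_le_one.mpr (by linarith)
  let e : Fin (k / 2) × Bool → Fin k := fun x => ⟨2 * x.1 + x.2.toNat, by
    have := x.1.isLt; have := Bool.toNat_lt x.2; omega⟩
  have he : e.Injective := by
    rintro ⟨i, b⟩ ⟨j, c⟩ h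
    have h' : 2 * (i : ℕ) + b.toNat = 2 * j + c.toNat := congrArg Fin.val h
    have hb := Bool.toNat_lt b
    have hc := Bool.toNat_lt c
    have h2 : b.toNat = c.toNat := by omega
    have h3 : i = j := Fin.ext (by omega)
    have h4 : b = c := by revert h2; cases b <;> cases c <;> simp
    rw [h3, h4]
  obtain ⟨p, hp⟩ := exists_isPairFamily hm h0 h1 he
  have hlog := hp.log_le hm h0 h1 hε hε1 hη hδ hδ1 he hA
  have hcard := hp.card_le hm h0 h1 hε hη hδ hδ1 he hA
  -- Worst case `k = 3`; for odd `k` the last letter has mass `0`. Adding the two bounds gives `3 *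
  -- 256 + 256 = 1024`.
  have hk3 : (k : ℝ) ≤ 3 * (k / 2 : ℕ) := by
    have : k ≤ 3 * (k / 2) := by omega
    exact_mod_cast this
  rw [mul_div_assoc', div_le_iff₀ hε]
  linarith

lemma le_sampleComplexity_klLoss {k : ℕ} (hk : 2 ≤ k) {ε δ : ℝ} (hε : 0 < ε) (hε1 : ε ≤ 1 / 128)
    (hδ : 0 < δ) (hδ1 : δ ≤ 1 / 16) :
    ENNReal.ofReal (1 / 1024 * ((k + Real.log (1 / δ)) / ε)) ≤
      ((sampleComplexity (klLoss (k := k)) ε δ : ℕ∞) : ℝ≥0∞) := by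
  set x := 1 / 1024 * ((k + Real.log (1 / δ)) / ε)
  have h : ((⌈x⌉₊ : ℕ) : ℕ∞) ≤ sampleComplexity (klLoss (k := k)) ε δ := by
    refine le_iInf₂ fun n ⟨A, hA⟩ => ?_
    exact_mod_cast Nat.ceil_le.mpr (hA.le_mul hk hε hε1 hδ hδ1)
  calc ENNReal.ofReal x ≤ ENNReal.ofReal (⌈x⌉₊ : ℕ) := ENNReal.ofReal_le_ofReal (Nat.le_ceil x)
    _ = (((⌈x⌉₊ : ℕ) : ℕ∞) : ℝ≥0∞) := by rw [ENat.toENNReal_coe, ENNReal.ofReal_natCast]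
    _ ≤ _ := by exact_mod_cast h

theorem mainTheorem3 :
    ∃ c C ε₀ δ₀ : ℝ, 0 < c ∧ 0 < C ∧ 0 < ε₀ ∧ 0 < δ₀ ∧
      -- lower bound, for all estimators
      (∀ k : ℕ, 2 ≤ k → ∀ ε δ : ℝ, 0 < ε → ε ≤ ε₀ → 0 < δ → δ ≤ δ₀ →
        ENNReal.ofReal (c * ((k + Real.log (1 / δ)) / ε)) ≤
          ((sampleComplexity (klLoss (k := k)) ε δ : ℕ∞) : ℝ≥0∞)) ∧
      -- upper bound
      (∀ k : ℕ, 1 ≤ k → ∀ ε δ : ℝ, 0 < ε → ε ≤ 1 → 0 < δ → δ ≤ 1 →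
        ((sampleComplexity (klLoss (k := k)) ε δ : ℕ∞) : ℝ≥0∞) ≤
          ENNReal.ofReal (C * ((k + Real.log (1 / δ)) / ε))) ∧
      -- the upper bound is achieved by the empirical estimator
      (∀ k : ℕ, 1 ≤ k → ∀ ε δ : ℝ, 0 < ε → 0 < δ → δ ≤ 1 →
        ∀ (n : ℕ) [NeZero n], C * ((k + Real.log (1 / δ)) / ε) ≤ n →
          (empiricalEstimator k n).Learns klLoss ε δ) := by
  refine ⟨1 / 1024, 5, 1 / 128, 1 / 16, by norm_num, by norm_num, by norm_num, by norm_num,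
    fun k hk ε δ hε hε1 hδ hδ1 => le_sampleComplexity_klLoss hk hε hε1 hδ hδ1,
    fun k hk ε δ hε hε1 hδ hδ1 => sampleComplexity_klLoss_le hk hε hε1 hδ hδ1,
    fun k _ ε δ hε hδ hδ1 n _ hn => empiricalEstimator_learns hε hδ hδ1 n (le_trans ?_ hn)⟩
  have hL : 0 ≤ Real.log (1 / δ) := Real.log_nonneg (by rw [le_div_iff₀ hδ]; linarith)
  gcongr
  norm_num
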